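/- Let $S^1$ be the circle group and $dz$ its normalized Lebesgue measure. Let $P_1,P_2,\dots$ be trigonometric polynomials such that (i) $\int_{S^1}|P_{i_1}P_{i_2}\cdots P_{i_k}|^2\,dz=1$ for all $i_1<i_2<\cdots<i_k$, and (ii) for every infinite sequence $i_1<i_2<\cdots$ the measures $|P_{i_1}\cdots P_{i_k}|^2\,dz$ converge weakly as $k\to\infty$, and let $\mu=\prod_{j=1}^\infty|P_j|^2$ be the corresponding generalized Riesz product, i.e. the weak limit of $|P_1\cdots P_n|^2\,dz$ as $n\to\infty$. Let $\frac{d\mu_a}{dz}$ be the density of the part of $\mu$ that is absolutely continuous with respect to $dz$. Integrals of logarithms are taken in $[-\infty,\infty)$, with $\log 0=-\infty$. For each $k$ let $z^{-m_k}P_k(z)=a_0+a_1z+\cdots+a_dz^d$ with $a_0\ne0$, $a_d\neq 0$, where $m_k$ is the lowest exponent occurring in $P_k$ (so $m_k=0$ if $P_k$ is analytic with non-zero constant term), and let $$O_k(z)=\gamma\,a_d\prod_{|a|<1}(1-\overline a z)\prod_{|c|\ge1}(z-c)$$ be its outer part, where $a$ and $c$ run over the zeros of this polynomial, with multiplicity,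 and $\gamma$, $|\gamma|=1$, is such that the constant term $\alpha_0^{(k)}=O_k(0)$ is positive. Then the infinite product $\beta=\prod_{k=1}^\infty\alpha_0^{(k)}$ converges in $[0,\infty)$ (with value $0$ allowed), and $$\int_{S^1}\log\frac{d\mu_a}{dz}\,dz=\lim_{n\to\infty}\int_{S^1}\log\prod_{j=1}^n|P_j(z)|^2\,dz=\log\prod_{k=1}^\infty|\alpha_0^{(k)}|^2 .$$ Moreover, if every $P_k$ is outer (that is, the functions $z^nP_k$, $n\ge0$, span $H^2$ in the closed linear sense, where $H^2\subset L^2(S^1,dz)$ consists of the functions whose Fourier coefficients of negative index vanish), then $\alpha_0^{(k)}$ is the modulus of the constant term of $P_k$ for every $k$, and $\log\frac{d\mu_a}{dz}$ has finite integral, i.e. $\int_{S^1}\bigl|\log\frac{d\mu_a}{dz}\bigr|\,dz<\infty$, if and only if $\beta>0$. -/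

import Mathlib

open MeasureTheory Filter Topology
open scoped ENNReal ComplexConjugate LaurentPolynomial Polynomial

noncomputable section

namespace RieszProduct

instance factTwoPiPos : Fact (0 < 2 * Real.pi) := ⟨Real.two_pi_pos⟩

/-- The circle group `S¹`, with the angle `t` (mod `2π`) standing for the point `z = e^{it}`. -/
abbrev S1 : Type := AddCircle (2 * Real.pi)

/-- The normalized Lebesgue measure `dz` on the circle group. -/
abbrev dz : Measure S1 := AddCircle.haarAddCircle

/-- The trigonometric polynomial `∑ aₙ zⁿ` (finite sum over `n ∈ ℤ`) as a function on the circle;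
`fourier n t = e^{int} = zⁿ`. -/
def trigFun (p : ℂ[T;T⁻¹]) : C(S1, ℂ) :=
  ∑ n ∈ p.coeff.support, p.coeff n • fourier n

/-- The finite measure `|f|² dz` for a continuous function `f` on the circle. -/
def sqMeasure (f : C(S1, ℂ)) : FiniteMeasure S1 :=
  ⟨dz.withDensity fun t => ENNReal.ofReal (‖f t‖ ^ 2), by
    refine isFiniteMeasure_withDensity_ofReal (Integrable.hasFiniteIntegral ?_)
    have h : Continuous fun t => ‖f t‖ ^ 2 := by fun_prop
    exact h.integrable_of_hasCompactSupport (HasCompactSupport.of_compactSpace _)⟩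

/-- `μ` is the generalized Riesz product `∏ |P_j|²` of the trigonometric polynomials
`P 0, P 1, …`. Convergence in `FiniteMeasure S1` is weak convergence of measures. -/
structure IsGeneralizedRieszProduct (P : ℕ → ℂ[T;T⁻¹]) (μ : FiniteMeasure S1) : Prop where
  integral_eq_one : ∀ s : Finset ℕ, ∫ t, ‖(∏ i ∈ s, trigFun (P i)) t‖ ^ 2 ∂dz = 1
  exists_weak_limit : ∀ i : ℕ → ℕ, StrictMono i → ∃ ν : FiniteMeasure S1,
    Tendsto (fun n => sqMeasure (∏ k ∈ Finset.range n, trigFun (P (i k)))) atTop (𝓝 ν)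
  tendsto : Tendsto (fun n => sqMeasure (∏ k ∈ Finset.range n, trigFun (P k))) atTop (𝓝 μ)

/-- The density `dμ_a/dz` of the absolutely continuous part of `μ`. -/
def acDensity (μ : FiniteMeasure S1) : S1 → ℝ≥0∞ :=
  (μ : Measure S1).rnDeriv dz

/-- The integral `∫ log f dz ∈ [-∞, ∞]` of the logarithm of a nonnegative function, with
`log 0 = -∞`: the integral of the positive part minus that of the negative part. For `f` with
`∫ f dz < ∞` the former is finite, as `log⁺ x ≤ x`, so that the difference is meaningful. -/
def logIntegral (f : S1 → ℝ≥0∞) : EReal :=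
  ((∫⁻ t, (ENNReal.log (f t)).toENNReal ∂dz : ℝ≥0∞) : EReal)
    - ((∫⁻ t, (-ENNReal.log (f t)).toENNReal ∂dz : ℝ≥0∞) : EReal)

/-- `log f`, with `log 0 = -∞`, has a finite integral: `∫ |log f| dz < ∞`. -/
def LogIntegrable (f : S1 → ℝ≥0∞) : Prop :=
  ∫⁻ t, (ENNReal.log (f t)).abs ∂dz < ∞

/-- The analytic polynomial `z^{-m} p(z)`, where `m` is the lowest exponent occurring in `p`. It has
the same modulus as `p` on the circle, and a nonzero constant term if `p ≠ 0`. It is `p` itself if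
`p` is analytic with nonzero constant term. -/
def toAnalytic (p : ℂ[T;T⁻¹]) : ℂ[X] :=
  LaurentPolynomial.trunc (p * LaurentPolynomial.T (-(p.coeff.support.min.untopD 0)))

/-- `a_m ∏_{|a| < 1} (1 - ā z) ∏_{|b| ≥ 1} (z - b)`, the products running over the zeros of
`q` with multiplicity and `a_m` being its leading coefficient. -/
def outerFactor (q : ℂ[X]) : ℂ[X] :=
  Polynomial.C q.leadingCoeff *
    (q.roots.map fun a => if ‖a‖ < 1 then 1 - Polynomial.C (conj a) * Polynomial.X
      else Polynomial.X - Polynomial.C a).prod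

/-- The outer part of a polynomial: `outerFactor q` times the unimodular constant `γ` that makes
its constant term positive. -/
def outerPart (q : ℂ[X]) : ℂ[X] :=
  Polynomial.C (conj ((outerFactor q).coeff 0) / (‖(outerFactor q).coeff 0‖ : ℂ)) * outerFactor q

/-- The constant term `α` of the outer part of a trigonometric polynomial (written analytically).
For `p ≠ 0` this constant term is positive, hence equal to its modulus. -/
def outerConst (p : ℂ[T;T⁻¹]) : ℝ :=
  ‖(outerPart (toAnalytic p)).coeff 0‖

/-- The Hardy space `H²`, as the set of the functions in `L²(S¹, dz)` whose Fourier coefficients of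
negative index vanish. -/
def hardyH2 : Set (Lp ℂ 2 dz) :=
  {f | ∀ n : ℤ, n < 0 → fourierCoeff (f : S1 → ℂ) n = 0}

/-- A trigonometric polynomial `p` is outer: the functions `zⁿ p`, `n ≥ 0`, span `H²` in the closed
linear sense. -/
def IsOuter (p : ℂ[T;T⁻¹]) : Prop :=
  ((Submodule.span ℂ (Set.range fun n : ℕ =>
      ContinuousMap.toLp (E := ℂ) 2 dz ℂ (fourier (n : ℤ) * trigFun p))).topologicalClosure :
    Set (Lp ℂ 2 dz)) = hardyH2

end RieszProduct

end

open RieszProduct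

noncomputable section

namespace RieszProduct

/-! Write `α_k` for the constant term of the outer part of `P_k`. It is the Mahler measure of the
analytic form of `P_k`, so Jensen's formula gives `∫ log |P_k|² dz = log α_k²`, and the statement
for finite products follows by addition. Jensen's inequality together with `∫ |P_k|² dz = 1` gives
`α_k ≤ 1`, whence the product converges. It remains to prove `∫ log (dμ_a/dz) dz = log ∏ α_k²`.

Upper bound (`logIntegral_acDensity_le`): `μ = |P_1 ⋯ P_n|² ν`, where the tail `ν` has mass one. The
densities factor in the same way, and `log u ≤ u - 1` shows that the density of `ν` contributes at
most `0`. Then let `n → ∞`.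

Lower bound, needed only when `∏ α_k² > 0`: Jensen's inequality for `|P_1 ⋯ P_n|² g`, with `g > 0`
continuous, survives the weak limit and gives `∏ α_k² · exp ∫ log g dz ≤ ∫ g dμ`
(`exp_add_integral_log_le`). As in Szegő's theorem, this extends to measurable `g`. Taking for `g` a
truncated inverse of `dμ_a/dz`, made small where the singular part lives, yields the bound
(`le_logIntegral_acDensity`).

For outer `P_k`, the Szegő kernel excludes zeros in the open disc, so `α_k` is the modulus of the
constant term. -/

/-! ### Laurent polynomials as functions on the circle -/

theorem trigFun_eq_sum (p : ℂ[T;T⁻¹]) :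
    trigFun p = p.coeff.sum fun n c => c • (fourier n : C(S1, ℂ)) := rfl

theorem trigFun_add (p q : ℂ[T;T⁻¹]) : trigFun (p + q) = trigFun p + trigFun q := by
  simp only [trigFun_eq_sum, AddMonoidAlgebra.coeff_add]
  exact Finsupp.sum_add_index' (by simp) (by intros; simp [add_smul])

theorem trigFun_C_mul_T (r : ℂ) (n : ℤ) :
    trigFun (LaurentPolynomial.C r * LaurentPolynomial.T n) = r • fourier n := by
  rw [← LaurentPolynomial.single_eq_C_mul_T, trigFun_eq_sum, AddMonoidAlgebra.coeff_single,
    Finsupp.sum_single_index (by simp)]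

theorem trigFun_mul_T (p : ℂ[T;T⁻¹]) (m : ℤ) :
    trigFun (p * LaurentPolynomial.T m) = trigFun p * fourier m := by
  induction p using LaurentPolynomial.induction_on' with
  | add p q hp hq => rw [add_mul, trigFun_add, hp, hq, trigFun_add, add_mul]
  | C_mul_T n a =>
    rw [LaurentPolynomial.mul_T_assoc, trigFun_C_mul_T, trigFun_C_mul_T]
    ext t
    simp [fourier_add, -fourier_apply]

theorem trigFun_toLaurent (q : ℂ[X]) (t : S1) :
    trigFun (Polynomial.toLaurent q) t = q.eval (AddCircle.toCircle t : ℂ) := by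
  induction q using Polynomial.induction_on' with
  | add p q hp hq => simp [trigFun_add, hp, hq]
  | monomial n a =>
    rw [Polynomial.toLaurent_C_mul_T, trigFun_C_mul_T]
    simp [AddCircle.toCircle_nsmul]

theorem coeff_toLaurent_natCast (q : ℂ[X]) (n : ℕ) :
    (Polynomial.toLaurent q).coeff (n : ℤ) = q.coeff n := by
  rw [LaurentPolynomial.coeff_toLaurent]
  exact Finsupp.mapDomain_apply Nat.cast_injective _ _

theorem coeff_toLaurent_of_neg (q : ℂ[X]) {n : ℤ} (hn : n < 0) :
    (Polynomial.toLaurent q).coeff n = 0 := by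
  rw [LaurentPolynomial.coeff_toLaurent]
  refine Finsupp.mapDomain_of_notMem_range _ _ ?_
  rintro ⟨k, rfl⟩
  simp at hn
  omega

theorem coeff_trunc (f : ℂ[T;T⁻¹]) (n : ℕ) :
    (LaurentPolynomial.trunc f).coeff n = f.coeff n := rfl

theorem toLaurent_trunc {f : ℂ[T;T⁻¹]} (hf : ∀ n < 0, f.coeff n = 0) :
    Polynomial.toLaurent (LaurentPolynomial.trunc f) = f := by
  refine LaurentPolynomial.ext fun n => ?_
  rcases lt_or_ge n 0 with hn | hn
  · rw [coeff_toLaurent_of_neg _ hn, hf n hn]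
  · lift n to ℕ using hn
    rw [coeff_toLaurent_natCast, coeff_trunc]

theorem coeff_mul_T (p : ℂ[T;T⁻¹]) (m n : ℤ) :
    (p * LaurentPolynomial.T m).coeff n = p.coeff (n - m) := by
  rw [LaurentPolynomial.T, AddMonoidAlgebra.coeff_mul_single_apply, mul_one, sub_eq_add_neg]

theorem toLaurent_toAnalytic (p : ℂ[T;T⁻¹]) :
    Polynomial.toLaurent (toAnalytic p) =
      p * LaurentPolynomial.T (-(p.coeff.support.min.untopD 0)) := by
  refine toLaurent_trunc fun n hn => ?_
  rw [coeff_mul_T]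
  by_contra h
  have hmem := Finsupp.mem_support_iff.2 h
  obtain ⟨m, hm⟩ := Finset.min_of_mem hmem
  have := Finset.min_le_of_eq hmem hm
  rw [hm] at this
  simp at this
  omega

theorem norm_trigFun (p : ℂ[T;T⁻¹]) (t : S1) :
    ‖trigFun p t‖ = ‖(toAnalytic p).eval (AddCircle.toCircle t : ℂ)‖ := by
  rw [← trigFun_toLaurent, toLaurent_toAnalytic, trigFun_mul_T, ContinuousMap.mul_apply, norm_mul,
    fourier_apply, Circle.norm_coe, mul_one]

/-! ### Outer parts, Mahler measure and integrals over the circle -/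

/-- A factor `1 - ā z` has constant term `1` and a factor `z - c` has `-c`. The moduli are thus `max
1 |a|` over all roots, exactly the factors of the Mahler measure. -/
theorem norm_coeff_zero_outerFactor (q : ℂ[X]) :
    ‖(outerFactor q).coeff 0‖ = q.mahlerMeasure := by
  have hnorm (s : Multiset ℂ) : ‖s.prod‖ = (s.map norm).prod := map_multiset_prod normHom s
  rw [Polynomial.mahlerMeasure_eq_leadingCoeff_mul_prod_roots, outerFactor,
    Polynomial.mul_coeff_zero, norm_mul, Polynomial.coeff_C_zero,
    Polynomial.coeff_zero_multiset_prod, hnorm, Multiset.map_map, Multiset.map_map]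
  congr 2
  refine Multiset.map_congr rfl fun a _ => ?_
  simp only [Function.comp_apply]
  split_ifs with h
  · simp [h.le]
  · simp [not_lt.1 h]

theorem outerConst_eq_mahlerMeasure (p : ℂ[T;T⁻¹]) :
    outerConst p = (toAnalytic p).mahlerMeasure := by
  rw [← norm_coeff_zero_outerFactor, outerConst, outerPart, Polynomial.mul_coeff_zero, norm_mul,
    Polynomial.coeff_C_zero]
  -- In the degenerate case `γ` is `0 / 0 = 0`, and both sides vanish.
  by_cases h : (outerFactor (toAnalytic p)).coeff 0 = 0
  · simp [h]
  · simp [h]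

theorem integrable_dz_of_intervalIntegrable {f : S1 → ℝ} (hm : Measurable f)
    (hf : IntervalIntegrable (fun x : ℝ => f x) volume 0 (2 * Real.pi)) : Integrable f dz := by
  rw [intervalIntegrable_iff_integrableOn_Ioc_of_le Real.two_pi_pos.le] at hf
  have h := (AddCircle.measurePreserving_mk (2 * Real.pi) 0).integrable_comp
    hm.aestronglyMeasurable (g := f)
  rw [zero_add] at h
  have hv := h.1 hf
  rw [AddCircle.volume_eq_smul_haarAddCircle] at hv
  exact (integrable_smul_measure (by simp [Real.pi_pos]) ENNReal.ofReal_ne_top).1 hv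

theorem circleMap_eq_toCircle (x : ℝ) :
    circleMap 0 1 x = (AddCircle.toCircle (x : S1) : ℂ) := by
  have := fourier_coe_apply (T := 2 * Real.pi) (n := 1) (x := x)
  rw [fourier_one] at this
  rw [this, circleMap]
  have h : (2 * Real.pi : ℂ) ≠ 0 := by exact_mod_cast Real.two_pi_pos.ne'
  push_cast
  field_simp
  simp [mul_comm]

theorem integral_toCircle {E : Type*} [NormedAddCommGroup E] [NormedSpace ℝ E] (f : ℂ → E) :
    ∫ t : S1, f (AddCircle.toCircle t) ∂dz = Real.circleAverage f 0 1 := by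
  rw [AddCircle.integral_haarAddCircle, ← AddCircle.intervalIntegral_preimage _ 0,
    Real.circleAverage_def, zero_add]
  simp only [circleMap_eq_toCircle]

theorem integrable_log_norm_eval (q : ℂ[X]) :
    Integrable (fun t : S1 => Real.log ‖q.eval (AddCircle.toCircle t : ℂ)‖) dz := by
  have hc : Continuous fun t : S1 => q.eval (AddCircle.toCircle t : ℂ) :=
    q.continuous.comp (continuous_subtype_val.comp AddCircle.continuous_toCircle)
  refine integrable_dz_of_intervalIntegrable hc.norm.measurable.log ?_
  simpa only [circleMap_eq_toCircle] using q.intervalIntegrable_mahlerMeasure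

theorem ae_eval_ne_zero {q : ℂ[X]} (hq : q ≠ 0) :
    ∀ᵐ t : S1 ∂dz, q.eval (AddCircle.toCircle t : ℂ) ≠ 0 := by
  have hfin : {t : S1 | q.eval (AddCircle.toCircle t : ℂ) = 0}.Finite := by
    refine Set.Finite.of_finite_image (f := fun t : S1 => (AddCircle.toCircle t : ℂ))
      (q.roots.toFinset.finite_toSet.subset ?_) ?_
    · rintro _ ⟨t, ht, rfl⟩
      simpa [hq] using ht
    · exact (Subtype.val_injective.comp
        (AddCircle.injective_toCircle Real.two_pi_pos.ne')).injOn
  have hna : NullSingletonClass dz := by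
    refine ⟨fun x => ?_⟩
    have h : (volume : Measure S1) {x} = 0 := by
      rw [← Metric.closedBall_zero, AddCircle.volume_closedBall]
      simp [Real.pi_pos.le]
    rw [AddCircle.volume_eq_smul_haarAddCircle, Measure.smul_apply, smul_eq_mul] at h
    exact (mul_eq_zero.1 h).resolve_left (by simp [Real.pi_pos])
  simpa [ae_iff] using hfin.measure_zero dz

/-! ### Extended-valued integrals of logarithms -/

theorem logIntegral_eq_integral {f : S1 → ℝ≥0∞} {F : S1 → ℝ}
    (h : ∀ᵐ t ∂dz, 0 < F t ∧ f t = ENNReal.ofReal (F t))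
    (hF : Integrable (fun t => Real.log (F t)) dz) :
    logIntegral f = ((∫ t, Real.log (F t) ∂dz : ℝ) : EReal) := by
  have h1 : ∫⁻ t, (ENNReal.log (f t)).toENNReal ∂dz
      = ∫⁻ t, ENNReal.ofReal (Real.log (F t)) ∂dz := by
    refine lintegral_congr_ae (h.mono fun t ht => ?_)
    simp only
    rw [ht.2, ENNReal.log_ofReal_of_pos ht.1, EReal.real_coe_toENNReal]
  have h2 : ∫⁻ t, (-ENNReal.log (f t)).toENNReal ∂dz
      = ∫⁻ t, ENNReal.ofReal (-Real.log (F t)) ∂dz := by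
    refine lintegral_congr_ae (h.mono fun t ht => ?_)
    simp only
    rw [ht.2, ENNReal.log_ofReal_of_pos ht.1, ← EReal.coe_neg, EReal.real_coe_toENNReal]
  have f1 : ∫⁻ t, ENNReal.ofReal (Real.log (F t)) ∂dz ≠ ∞ := hF.lintegral_lt_top.ne
  have f2 : ∫⁻ t, ENNReal.ofReal (-Real.log (F t)) ∂dz ≠ ∞ := hF.neg.lintegral_lt_top.ne
  rw [logIntegral, h1, h2, integral_eq_lintegral_pos_part_sub_lintegral_neg_part hF, EReal.coe_sub,
    EReal.coe_ennreal_toReal f1, EReal.coe_ennreal_toReal f2]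

theorem measurable_neg_log_toENNReal {f : S1 → ℝ≥0∞} (hf : Measurable f) :
    Measurable fun t => (-ENNReal.log (f t)).toENNReal := by
  fun_prop

theorem toENNReal_log_le (x : ℝ≥0∞) : (ENNReal.log x).toENNReal ≤ x := by
  induction x using ENNReal.recTopCoe with
  | top => simp
  | coe x =>
    rcases eq_or_ne x 0 with rfl | hx
    · simp
    · rw [ENNReal.log_of_nnreal hx, EReal.real_coe_toENNReal]
      refine ENNReal.ofReal_le_of_le_toReal ?_
      have := Real.log_le_sub_one_of_pos (show (0 : ℝ) < x by positivity)
      simp only [ENNReal.coe_toReal]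
      linarith

/-- Since `log⁺ x ≤ x`, only the negative part of the logarithm can diverge. Once it has finite
integral, `f` cannot vanish on a set of positive measure. -/
theorem ae_pos_and_integrable_log {f : S1 → ℝ≥0∞} (hf : Measurable f)
    (hfin : ∫⁻ t, f t ∂dz ≠ ∞) (hneg : ∫⁻ t, (-ENNReal.log (f t)).toENNReal ∂dz ≠ ∞) :
    (∀ᵐ t ∂dz, 0 < (f t).toReal ∧ f t = ENNReal.ofReal (f t).toReal) ∧
      Integrable (fun t => Real.log (f t).toReal) dz := by
  have hpos : ∀ᵐ t ∂dz, 0 < (f t).toReal ∧ f t = ENNReal.ofReal (f t).toReal := by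
    filter_upwards [ae_lt_top hf hfin, ae_lt_top (measurable_neg_log_toENNReal hf) hneg]
      with t h1 h2
    refine ⟨ENNReal.toReal_pos (fun h0 => ?_) h1.ne, (ENNReal.ofReal_toReal h1.ne).symm⟩
    simp [h0] at h2
  refine ⟨hpos, hf.ennreal_toReal.log.aestronglyMeasurable, ?_⟩
  have hle : ∫⁻ t, ‖Real.log (f t).toReal‖ₑ ∂dz
      ≤ ∫⁻ t, (f t + (-ENNReal.log (f t)).toENNReal) ∂dz := by
    refine lintegral_mono_ae (hpos.mono fun t ht => ?_)
    have hlog : ENNReal.log (f t) = Real.log (f t).toReal := ENNReal.log_pos_real' ht.1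
    have h1 := toENNReal_log_le (f t)
    rw [hlog, EReal.real_coe_toENNReal] at h1
    rw [hlog, ← EReal.coe_neg, EReal.real_coe_toENNReal, Real.enorm_eq_ofReal_abs]
    rcases abs_cases (Real.log (f t).toReal) with h | h <;> rw [h.1]
    · exact h1.trans le_self_add
    · exact le_add_self
  rw [lintegral_add_left hf] at hle
  exact hle.trans_lt (ENNReal.add_lt_top.2 ⟨hfin.lt_top, hneg.lt_top⟩)

theorem logIntegral_eq_bot {f : S1 → ℝ≥0∞}
    (hneg : ∫⁻ t, (-ENNReal.log (f t)).toENNReal ∂dz = ∞) :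
    logIntegral f = ⊥ := by
  rw [logIntegral, hneg, EReal.coe_ennreal_top, EReal.sub_top]

theorem logIntegral_eq_integral_toReal {f : S1 → ℝ≥0∞} (hf : Measurable f)
    (hfin : ∫⁻ t, f t ∂dz ≠ ∞) (hneg : ∫⁻ t, (-ENNReal.log (f t)).toENNReal ∂dz ≠ ∞) :
    logIntegral f = ((∫ t, Real.log (f t).toReal ∂dz : ℝ) : EReal) :=
  have h := ae_pos_and_integrable_log hf hfin hneg
  logIntegral_eq_integral h.1 h.2

theorem logIntegrable_iff {f : S1 → ℝ≥0∞} (hf : Measurable f) (hfin : ∫⁻ t, f t ∂dz ≠ ∞) :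
    LogIntegrable f ↔ logIntegral f ≠ ⊥ := by
  constructor
  · intro h
    have hneg : ∫⁻ t, (-ENNReal.log (f t)).toENNReal ∂dz ≠ ∞ := by
      refine ((lintegral_mono fun t => ?_).trans_lt h).ne
      induction ENNReal.log (f t) with
      | bot => simp
      | top => simp
      | coe x =>
        rw [← EReal.coe_neg, EReal.real_coe_toENNReal, EReal.abs_def]
        exact ENNReal.ofReal_le_ofReal (neg_le_abs x)
    rw [logIntegral_eq_integral_toReal hf hfin hneg]
    exact EReal.coe_ne_bot _
  · intro h
    have h' := ae_pos_and_integrable_log hf hfin fun hneg => h (logIntegral_eq_bot hneg)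
    refine lt_of_eq_of_lt (lintegral_congr_ae (h'.1.mono fun t ht => ?_)) h'.2.2
    simp only
    rw [ENNReal.log_pos_real' ht.1, EReal.abs_def, Real.enorm_eq_ofReal_abs]

/-- Here `log w = log F + log u`, and `∫ log u ≤ ∫ (u - 1) ≤ 0`. In the application `F` is a finite
product and `u` the density of the tail. -/
theorem logIntegral_mul_le {w u : S1 → ℝ≥0∞} {F : S1 → ℝ} (hw : Measurable w)
    (hwfin : ∫⁻ t, w t ∂dz ≠ ∞) (hu : Measurable u) (hu1 : ∫⁻ t, u t ∂dz ≤ 1)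
    (hF : ∀ᵐ t ∂dz, 0 < F t) (hlogF : Integrable (fun t => Real.log (F t)) dz)
    (hwu : ∀ᵐ t ∂dz, w t = ENNReal.ofReal (F t) * u t) :
    logIntegral w ≤ ((∫ t, Real.log (F t) ∂dz : ℝ) : EReal) := by
  by_cases hneg : ∫⁻ t, (-ENNReal.log (w t)).toENNReal ∂dz = ∞
  · rw [logIntegral_eq_bot hneg]
    exact bot_le
  rw [logIntegral_eq_integral_toReal hw hwfin hneg, EReal.coe_le_coe_iff]
  obtain ⟨hpos, hint⟩ := ae_pos_and_integrable_log hw hwfin hneg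
  have hu_ne : ∫⁻ t, u t ∂dz ≠ ∞ := (hu1.trans_lt ENNReal.one_lt_top).ne
  have hu_int : Integrable (fun t => (u t).toReal) dz :=
    integrable_toReal_of_lintegral_ne_top hu.aemeasurable hu_ne
  have hu_le : ∫ t, (u t).toReal ∂dz ≤ 1 := by
    rw [integral_toReal hu.aemeasurable (ae_lt_top hu hu_ne)]
    exact ENNReal.toReal_le_of_le_ofReal zero_le_one (by simpa using hu1)
  have hle : ∫ t, (Real.log (w t).toReal - Real.log (F t)) ∂dz ≤ ∫ t, ((u t).toReal - 1) ∂dz := by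
    refine integral_mono_ae (hint.sub hlogF) (hu_int.sub (integrable_const 1)) ?_
    filter_upwards [hpos, hF, hwu] with t h1 h2 h3
    have hmul : (w t).toReal = F t * (u t).toReal := by
      rw [h3, ENNReal.toReal_mul, ENNReal.toReal_ofReal h2.le]
    have hupos : 0 < (u t).toReal := by
      have := h1.1
      rw [hmul] at this
      exact (pos_iff_pos_of_mul_pos this).1 h2
    rw [hmul, Real.log_mul h2.ne' hupos.ne']
    linarith [Real.log_le_sub_one_of_pos hupos]
  rw [integral_sub hint hlogF, integral_sub hu_int (integrable_const 1), integral_const,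
    probReal_univ, one_smul] at hle
  linarith

/-! ### Jensen's inequality and its extension to measurable test functions -/

theorem exp_integral_log_le {h : S1 → ℝ} (hpos : ∀ᵐ t ∂dz, 0 < h t) (hint : Integrable h dz)
    (hlog : Integrable (fun t => Real.log (h t)) dz) :
    Real.exp (∫ t, Real.log (h t) ∂dz) ≤ ∫ t, h t ∂dz := by
  have hexp : (fun t => Real.exp (Real.log (h t))) =ᵐ[dz] h :=
    hpos.mono fun t ht => Real.exp_log ht
  rw [← integral_congr_ae hexp]
  exact convexOn_exp.map_integral_le Real.continuous_exp.continuousOn isClosed_univ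
    (by simp) hlog (hint.congr hexp.symm)

theorem integrable_of_mem_Icc {m : Measure S1} [IsFiniteMeasure m] {g : S1 → ℝ} (hg : Measurable g)
    {a b : ℝ} (h : ∀ t, g t ∈ Set.Icc a b) : Integrable g m := by
  refine Integrable.of_bound hg.aestronglyMeasurable (max |a| |b|) (.of_forall fun t => ?_)
  exact abs_le_max_abs_abs (h t).1 (h t).2

theorem log_mem_Icc {a b x : ℝ} (ha : 0 < a) (h : x ∈ Set.Icc a b) :
    Real.log x ∈ Set.Icc (Real.log a) (Real.log b) :=
  ⟨Real.log_le_log ha h.1, Real.log_le_log (ha.trans_le h.1) h.2⟩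

/-- An inequality of Jensen type that holds for continuous positive functions passes to bounded
measurable functions that are bounded away from zero. -/
theorem exp_add_integral_log_le_of_measurable {μ : Measure S1} [IsFiniteMeasure μ] {l : ℝ}
    (hcont : ∀ g : C(S1, ℝ), (∀ t, 0 < g t) →
      Real.exp (l + ∫ t, Real.log (g t) ∂dz) ≤ ∫ t, g t ∂μ)
    {g : S1 → ℝ} (hg : Measurable g) {a b : ℝ} (ha : 0 < a) (hab : ∀ t, g t ∈ Set.Icc a b) :
    Real.exp (l + ∫ t, Real.log (g t) ∂dz) ≤ ∫ t, g t ∂μ := by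
  have key : ∀ ε > 0, Real.exp (l + (∫ t, Real.log (g t) ∂dz - ε / a)) ≤ ∫ t, g t ∂μ + ε := by
    intro ε hε
    -- Approximating in `L¹(μ + dz)` controls the errors for both measures with a single continuous
    -- function.
    have hgm : Integrable g (μ + dz) := integrable_of_mem_Icc hg hab
    obtain ⟨h, hh, hhi⟩ := hgm.exists_boundedContinuous_integral_sub_le hε
    have hab' : a ≤ b := (hab 0).1.trans (hab 0).2
    -- Clamping to `[a, b]` does not increase the distance to `g` and keeps the logarithm bounded.
    let k : C(S1, ℝ) := ⟨fun t => max a (min (h t) b), by fun_prop⟩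
    have hk : ∀ t, k t ∈ Set.Icc a b := fun t =>
      ⟨le_max_left _ _, max_le hab' (min_le_right _ _)⟩
    have hkm : Measurable k := k.continuous.measurable
    have hdist : ∀ t, |g t - k t| ≤ ‖g t - h t‖ := fun t => by
      have h1 : g t = max a (min (g t) b) := by
        rw [min_eq_left (hab t).2, max_eq_right (hab t).1]
      have h2 : |max a (min (g t) b) - max a (min (h t) b)| ≤ |min (g t) b - min (h t) b| := by
        simpa using abs_max_sub_max_le_max a (min (g t) b) a (min (h t) b)
      have h3 : |min (g t) b - min (h t) b| ≤ |g t - h t| := by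
        simpa using abs_min_sub_min_le_max (g t) b (h t) b
      calc |g t - k t| = |max a (min (g t) b) - max a (min (h t) b)| := by rw [← h1]; rfl
        _ ≤ _ := h2.trans h3
    have hgk : Integrable (fun t => |g t - k t|) (μ + dz) :=
      (hgm.sub (integrable_of_mem_Icc hkm hk)).abs
    have htot : ∫ t, |g t - k t| ∂μ + ∫ t, |g t - k t| ∂dz ≤ ε := by
      rw [← integral_add_measure (hgk.mono_measure (Measure.le_add_right le_rfl))
        (hgk.mono_measure (Measure.le_add_left le_rfl))]
      exact (integral_mono hgk (hgm.sub hhi).norm hdist).trans hh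
    have hn1 : 0 ≤ ∫ t, |g t - k t| ∂μ := integral_nonneg fun t => abs_nonneg _
    have hn2 : 0 ≤ ∫ t, |g t - k t| ∂dz := integral_nonneg fun t => abs_nonneg _
    have hgkμ : Integrable (fun t => |g t - k t|) μ :=
      hgk.mono_measure (Measure.le_add_right le_rfl)
    have hgkz : Integrable (fun t => |g t - k t|) dz :=
      hgk.mono_measure (Measure.le_add_left le_rfl)
    have hgμ : Integrable g μ := integrable_of_mem_Icc hg hab
    have h1 : ∫ t, k t ∂μ ≤ ∫ t, g t ∂μ + ∫ t, |g t - k t| ∂μ := by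
      rw [← integral_add hgμ hgkμ]
      refine integral_mono (integrable_of_mem_Icc hkm hk) (hgμ.add hgkμ) fun t => ?_
      have := neg_abs_le (g t - k t)
      change k t ≤ g t + |g t - k t|
      linarith
    have hlg : Integrable (fun t => Real.log (g t)) dz :=
      integrable_of_mem_Icc hg.log fun t => log_mem_Icc ha (hab t)
    have hlk : Integrable (fun t => Real.log (k t)) dz :=
      integrable_of_mem_Icc hkm.log fun t => log_mem_Icc ha (hk t)
    -- Pointwise, `log (g / k) ≤ g / k - 1 ≤ |g - k| / a`.
    have h2 : ∫ t, Real.log (g t) ∂dz - (∫ t, |g t - k t| ∂dz) / a ≤ ∫ t, Real.log (k t) ∂dz := by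
      rw [← integral_div, ← integral_sub hlg (hgkz.div_const a)]
      refine integral_mono (hlg.sub (hgkz.div_const a)) hlk fun t => ?_
      have hkp : 0 < k t := ha.trans_le (hk t).1
      have hgp : 0 < g t := ha.trans_le (hab t).1
      have hl := Real.log_le_sub_one_of_pos (div_pos hgp hkp)
      rw [Real.log_div hgp.ne' hkp.ne'] at hl
      have : g t / k t - 1 ≤ |g t - k t| / a := by
        rw [← div_self hkp.ne', ← sub_div]
        exact (div_le_div_of_nonneg_right (le_abs_self _) hkp.le).trans
          (div_le_div_of_nonneg_left (abs_nonneg _) ha (hk t).1)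
      change Real.log (g t) - |g t - k t| / a ≤ Real.log (k t)
      linarith
    have h3 : (∫ t, |g t - k t| ∂dz) / a ≤ ε / a := by gcongr; linarith
    refine (Real.exp_le_exp.2 ?_).trans ((hcont k fun t => ha.trans_le (hk t).1).trans ?_)
    · linarith
    · linarith
  have hl : Tendsto (fun ε : ℝ => Real.exp (l + (∫ t, Real.log (g t) ∂dz - ε / a))) (𝓝[>] 0)
      (𝓝 (Real.exp (l + (∫ t, Real.log (g t) ∂dz - 0 / a)))) :=
    (Continuous.tendsto (by fun_prop) 0).mono_left nhdsWithin_le_nhds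
  have hr : Tendsto (fun ε : ℝ => ∫ t, g t ∂μ + ε) (𝓝[>] 0) (𝓝 (∫ t, g t ∂μ + 0)) :=
    (Continuous.tendsto (by fun_prop) 0).mono_left nhdsWithin_le_nhds
  simpa using le_of_tendsto_of_tendsto hl hr (eventually_mem_nhdsWithin.mono key)

/-! ### Truncation -/

/-- Truncation of `x` to the interval `[1 / (n + 1), n + 1]`. -/
def clip (n : ℕ) (x : ℝ) : ℝ := max (n + 1 : ℝ)⁻¹ (min x (n + 1))

theorem continuous_clip (n : ℕ) : Continuous (clip n) := by
  unfold clip; fun_prop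

theorem inv_natCast_add_one_le (n : ℕ) : (n + 1 : ℝ)⁻¹ ≤ 1 :=
  inv_le_one_of_one_le₀ (by linarith [n.cast_nonneg (α := ℝ)])

theorem clip_mem_Icc (n : ℕ) (x : ℝ) : clip n x ∈ Set.Icc (n + 1 : ℝ)⁻¹ (n + 1) :=
  ⟨le_max_left _ _, max_le ((inv_natCast_add_one_le n).trans (by linarith [n.cast_nonneg (α := ℝ)]))
    (min_le_right _ _)⟩

theorem clip_pos (n : ℕ) (x : ℝ) : 0 < clip n x :=
  lt_of_lt_of_le (by positivity) (clip_mem_Icc n x).1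

theorem eventually_clip_eq {x : ℝ} (hx : 0 < x) : ∀ᶠ n in atTop, clip n x = x := by
  filter_upwards [(tendsto_natCast_atTop_atTop (R := ℝ)).eventually_ge_atTop x,
    (tendsto_natCast_atTop_atTop (R := ℝ)).eventually_ge_atTop x⁻¹] with n h1 h2
  rw [clip, min_eq_left (by linarith), max_eq_right]
  exact inv_le_of_inv_le₀ hx (by linarith)

theorem div_clip_le (n : ℕ) {x : ℝ} (hx : 0 ≤ x) : x / clip n x ≤ 1 + x / (n + 1) := by
  have hn : (0 : ℝ) < n + 1 := by positivity
  rcases le_total x (n + 1) with h | h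
  · have : x ≤ clip n x := by rw [clip, min_eq_left h]; exact le_max_right _ _
    have h1 : x / clip n x ≤ 1 := div_le_one_of_le₀ this (clip_pos n x).le
    have : 0 ≤ x / (n + 1) := by positivity
    linarith
  · have : (n + 1 : ℝ) ≤ clip n x := by rw [clip, min_eq_right h]; exact le_max_right _ _
    have : x / clip n x ≤ x / (n + 1) := by gcongr
    linarith

/-- The interval contains `1`, so truncation only moves `x` towards `1`. This is the domination
needed to let `n → ∞`. -/
theorem abs_log_clip_le (n : ℕ) {x : ℝ} (hx : 0 < x) : |Real.log (clip n x)| ≤ |Real.log x| := by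
  have hn : (1 : ℝ) ≤ n + 1 := by linarith [n.cast_nonneg (α := ℝ)]
  have hn' := inv_natCast_add_one_le n
  rcases le_total x 1 with h | h
  · have h1 : x ≤ clip n x := by rw [clip, min_eq_left (h.trans hn)]; exact le_max_right _ _
    have h2 : clip n x ≤ 1 := max_le hn' ((min_le_left _ _).trans h)
    have h3 := Real.log_le_log hx h1
    rw [abs_of_nonpos (Real.log_nonpos (clip_pos n x).le h2), abs_of_nonpos (Real.log_nonpos hx.le h)]
    linarith
  · have h1 : 1 ≤ clip n x := (le_min h hn).trans (le_max_right _ _)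
    have h2 : clip n x ≤ x := max_le (hn'.trans h) (min_le_left _ _)
    rw [abs_of_nonneg (Real.log_nonneg h1), abs_of_nonneg (Real.log_nonneg h)]
    exact Real.log_le_log (clip_pos n x) h2

/-- Provides a nonnegative majorant of the negative part of the logarithm whose integral can be
bounded uniformly in `n`. -/
theorem neg_log_clip_posPart_le (n : ℕ) {x : ℝ} (hx : 0 ≤ x) :
    max (-Real.log (clip n x)) 0 ≤ x - Real.log (clip n x) := by
  have hn : (1 : ℝ) ≤ n + 1 := by linarith [n.cast_nonneg (α := ℝ)]
  refine max_le (by linarith) ?_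
  rcases le_total x 1 with h | h
  · have h2 : clip n x ≤ 1 := max_le (inv_natCast_add_one_le n) ((min_le_left _ _).trans h)
    linarith [Real.log_nonpos (clip_pos n x).le h2]
  · have h2 : clip n x ≤ x := max_le ((inv_natCast_add_one_le n).trans h) (min_le_left _ _)
    linarith [Real.log_le_sub_one_of_pos (clip_pos n x)]

theorem tendsto_neg_log_clip {x : ℝ≥0∞} (hx : x ≠ ∞) :
    Tendsto (fun n => ENNReal.ofReal (-Real.log (clip n x.toReal))) atTop
      (𝓝 (-ENNReal.log x).toENNReal) := by
  rcases eq_or_ne x 0 with rfl | h0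
  · have : ∀ n : ℕ, ENNReal.ofReal (-Real.log (clip n (0 : ℝ≥0∞).toReal))
        = ENNReal.ofReal (Real.log (n + 1)) := fun n => by
      rw [clip, ENNReal.toReal_zero, min_eq_left (by positivity), max_eq_left (by positivity),
        Real.log_inv, neg_neg]
    simp only [this, ENNReal.log_zero, EReal.neg_bot, EReal.toENNReal_top]
    exact ENNReal.tendsto_ofReal_nhds_top.2 (Real.tendsto_log_atTop.comp
      (tendsto_atTop_add_const_right _ _ tendsto_natCast_atTop_atTop))
  · rw [ENNReal.log_pos_real h0 hx, ← EReal.coe_neg, EReal.real_coe_toENNReal]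
    refine tendsto_const_nhds.congr' ?_
    filter_upwards [eventually_clip_eq (ENNReal.toReal_pos h0 hx)] with n hn
    rw [hn]

/-! ### The lower bound in Szegő's theorem -/

section Szego

variable {μ : FiniteMeasure S1}

theorem measurable_acDensity : Measurable (acDensity μ) := Measure.measurable_rnDeriv _ _

theorem lintegral_acDensity_le : ∫⁻ t, acDensity μ t ∂dz ≤ (μ : Measure S1) Set.univ :=
  Measure.lintegral_rnDeriv_le

theorem lintegral_acDensity_ne_top : ∫⁻ t, acDensity μ t ∂dz ≠ ∞ :=
  (lintegral_acDensity_le.trans_lt (measure_lt_top _ _)).ne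

theorem integrable_acDensity_toReal : Integrable (fun t => (acDensity μ t).toReal) dz :=
  integrable_toReal_of_lintegral_ne_top measurable_acDensity.aemeasurable lintegral_acDensity_ne_top

theorem integral_acDensity_le (hmass : (μ : Measure S1) Set.univ ≤ 1) :
    ∫ t, (acDensity μ t).toReal ∂dz ≤ 1 := by
  rw [integral_toReal measurable_acDensity.aemeasurable
    (ae_lt_top measurable_acDensity lintegral_acDensity_ne_top)]
  exact ENNReal.toReal_le_of_le_ofReal zero_le_one
    (by simpa using lintegral_acDensity_le.trans hmass)

theorem integrable_log_clip_acDensity (n : ℕ) :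
    Integrable (fun t => Real.log (clip n (acDensity μ t).toReal)) dz :=
  integrable_of_mem_Icc
    ((continuous_clip n).measurable.comp measurable_acDensity.ennreal_toReal).log
    fun _ => log_mem_Icc (by positivity) (clip_mem_Icc n _)

/-- The test function is `1 / clip n W` almost everywhere for `dz` and `1 / (n + 1)` almost
everywhere for the singular part. Its logarithm integrates to `-∫ log (clip n W) dz`, while its
integral against `μ` is at most `1 + 2 / (n + 1)`. -/
theorem sub_le_integral_log_clip (hmass : (μ : Measure S1) Set.univ ≤ 1) {l : ℝ}
    (hcont : ∀ g : C(S1, ℝ), (∀ t, 0 < g t) →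
      Real.exp (l + ∫ t, Real.log (g t) ∂dz) ≤ ∫ t, g t ∂(μ : Measure S1)) (n : ℕ) :
    l - 2 * (n + 1 : ℝ)⁻¹ ≤ ∫ t, Real.log (clip n (acDensity μ t).toReal) ∂dz := by
  classical
  set W : S1 → ℝ := fun t => (acDensity μ t).toReal with hW
  have hWm : Measurable W := measurable_acDensity.ennreal_toReal
  have hWi : Integrable W dz := integrable_acDensity_toReal
  obtain ⟨N, hN, hσN, hzN⟩ := Measure.mutuallySingular_singularPart (μ : Measure S1) dz
  set σ := (μ : Measure S1).singularPart dz with hσ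
  have hn : (0 : ℝ) < n + 1 := by positivity
  -- `N` is null for the singular part and its complement is null for `dz`
  let g : S1 → ℝ := N.piecewise (fun t => (clip n (W t))⁻¹) fun _ => (n + 1 : ℝ)⁻¹
  have hgm : Measurable g :=
    Measurable.piecewise hN ((continuous_clip n).measurable.comp hWm).inv measurable_const
  have hgI : ∀ t, g t ∈ Set.Icc (n + 1 : ℝ)⁻¹ (n + 1) := fun t => by
    by_cases ht : t ∈ N
    · simp only [g, Set.piecewise_eq_of_mem _ _ _ ht]
      have := clip_mem_Icc n (W t)
      exact ⟨inv_anti₀ (clip_pos _ _) this.2, inv_le_of_inv_le₀ hn this.1⟩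
    · simp only [g, Set.piecewise_eq_of_notMem _ _ _ ht]
      have := clip_mem_Icc n 0
      exact ⟨le_rfl, this.1.trans this.2⟩
  have hmain := exp_add_integral_log_le_of_measurable hcont hgm (by positivity) hgI
  have hgz : ∀ᵐ t ∂dz, g t = (clip n (W t))⁻¹ := by
    have : ∀ᵐ t ∂dz, t ∈ N := by rw [ae_iff]; exact hzN
    filter_upwards [this] with t ht using Set.piecewise_eq_of_mem _ _ _ ht
  have hgσ : ∀ᵐ t ∂σ, g t = (n + 1 : ℝ)⁻¹ := by
    have : ∀ᵐ t ∂σ, t ∉ N := by rw [ae_iff]; simpa using hσN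
    filter_upwards [this] with t ht using Set.piecewise_eq_of_notMem _ _ _ ht
  have hlog : ∫ t, Real.log (g t) ∂dz = - ∫ t, Real.log (clip n (W t)) ∂dz := by
    rw [← integral_neg]
    refine integral_congr_ae (hgz.mono fun t ht => ?_)
    simp only
    rw [ht, Real.log_inv]
  have hσ1 : ∫ t, g t ∂σ ≤ (n + 1 : ℝ)⁻¹ := by
    rw [integral_congr_ae hgσ, integral_const, smul_eq_mul]
    refine mul_le_of_le_one_left (by positivity) ?_
    exact ENNReal.toReal_le_of_le_ofReal zero_le_one
      (by simpa using (Measure.singularPart_le _ _ _).trans hmass)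
  have hac : ∫ t, g t ∂(dz.withDensity ((μ : Measure S1).rnDeriv dz)) ≤ 1 + (n + 1 : ℝ)⁻¹ := by
    rw [integral_withDensity_eq_integral_toReal_smul (Measure.measurable_rnDeriv _ _)
      (Measure.rnDeriv_lt_top _ _)]
    have hle : ∫ t, ((μ : Measure S1).rnDeriv dz t).toReal • g t ∂dz
        ≤ ∫ t, (1 + W t / (n + 1)) ∂dz := by
      refine integral_mono_ae ?_ ((integrable_const 1).add (hWi.div_const _)) ?_
      · exact hWi.mul_bdd (c := n + 1) hgm.aestronglyMeasurable (.of_forall fun t => by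
          rw [Real.norm_eq_abs, abs_of_nonneg ((inv_pos.2 hn).le.trans (hgI t).1)]
          exact (hgI t).2)
      · filter_upwards [hgz] with t ht
        rw [ht, smul_eq_mul, ← div_eq_mul_inv]
        exact div_clip_le n ENNReal.toReal_nonneg
    rw [integral_add (integrable_const 1) (hWi.div_const _), integral_const, probReal_univ,
      one_smul, integral_div] at hle
    have : (∫ t, W t ∂dz) / (n + 1) ≤ 1 / (n + 1) := by
      gcongr; exact integral_acDensity_le hmass
    rw [one_div] at this
    linarith
  -- One `1 / (n + 1)` comes from the singular part, the other from the set where `W` exceeds the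
  -- truncation level.
  have hsum : ∫ t, g t ∂(μ : Measure S1) ≤ 1 + 2 * (n + 1 : ℝ)⁻¹ := by
    rw [Measure.haveLebesgueDecomposition_add (μ : Measure S1) dz,
      integral_add_measure (integrable_of_mem_Icc hgm hgI) (integrable_of_mem_Icc hgm hgI)]
    linarith
  rw [hlog] at hmain
  have := (hmain.trans hsum).trans (by
    have := Real.add_one_le_exp (2 * (n + 1 : ℝ)⁻¹)
    linarith : _ ≤ Real.exp (2 * (n + 1 : ℝ)⁻¹))
  rw [Real.exp_le_exp] at this
  linarith

/-- Fatou's lemma applied to the truncations, whose negative parts have uniformly bounded integrals.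
-/
theorem lintegral_neg_log_acDensity_ne_top (hmass : (μ : Measure S1) Set.univ ≤ 1) {l : ℝ}
    (hcont : ∀ g : C(S1, ℝ), (∀ t, 0 < g t) →
      Real.exp (l + ∫ t, Real.log (g t) ∂dz) ≤ ∫ t, g t ∂(μ : Measure S1)) :
    ∫⁻ t, (-ENNReal.log (acDensity μ t)).toENNReal ∂dz ≠ ∞ := by
  have hbound (n : ℕ) : ∫⁻ t, ENNReal.ofReal (-Real.log (clip n (acDensity μ t).toReal)) ∂dz
      ≤ ENNReal.ofReal (3 - l) := by
    have hi := integrable_log_clip_acDensity (μ := μ) n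
    calc ∫⁻ t, ENNReal.ofReal (-Real.log (clip n (acDensity μ t).toReal)) ∂dz
        ≤ ∫⁻ t, ENNReal.ofReal ((acDensity μ t).toReal
            - Real.log (clip n (acDensity μ t).toReal)) ∂dz :=
          lintegral_mono fun t => ENNReal.ofReal_le_ofReal
            ((le_max_left _ _).trans (neg_log_clip_posPart_le n ENNReal.toReal_nonneg))
      _ = ENNReal.ofReal (∫ t, ((acDensity μ t).toReal
            - Real.log (clip n (acDensity μ t).toReal)) ∂dz) :=
          (ofReal_integral_eq_lintegral_ofReal (integrable_acDensity_toReal.sub hi)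
            (.of_forall fun t => (le_max_right _ _).trans
              (neg_log_clip_posPart_le n ENNReal.toReal_nonneg))).symm
      -- In `3 = 1 + 2`, the `1` bounds the integral of the density and the `2` bounds `2 / (n +
      -- 1)`.
      _ ≤ ENNReal.ofReal (3 - l) := by
          refine ENNReal.ofReal_le_ofReal ?_
          rw [integral_sub integrable_acDensity_toReal hi]
          have h1 := sub_le_integral_log_clip hmass hcont n
          have h2 := inv_natCast_add_one_le n
          have h3 := integral_acDensity_le hmass
          linarith
  have hlim : ∫⁻ t, (-ENNReal.log (acDensity μ t)).toENNReal ∂dz = ∫⁻ t, liminf (fun n =>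
      ENNReal.ofReal (-Real.log (clip n (acDensity μ t).toReal))) atTop ∂dz := by
    refine lintegral_congr_ae ?_
    filter_upwards [ae_lt_top measurable_acDensity (lintegral_acDensity_ne_top (μ := μ))] with t ht
    exact (tendsto_neg_log_clip ht.ne).liminf_eq.symm
  rw [hlim]
  have hmeas (n : ℕ) :
      Measurable fun t => ENNReal.ofReal (-Real.log (clip n (acDensity μ t).toReal)) :=
    (((continuous_clip n).measurable.comp
      measurable_acDensity.ennreal_toReal).log.neg).ennreal_ofReal
  exact ((lintegral_liminf_le hmeas).trans_lt ((liminf_le_of_frequently_le'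
    (Frequently.of_forall hbound)).trans_lt ENNReal.ofReal_lt_top)).ne

/-- The lower bound in Szegő's theorem. -/
theorem le_logIntegral_acDensity (hmass : (μ : Measure S1) Set.univ ≤ 1) {l : ℝ}
    (hcont : ∀ g : C(S1, ℝ), (∀ t, 0 < g t) →
      Real.exp (l + ∫ t, Real.log (g t) ∂dz) ≤ ∫ t, g t ∂(μ : Measure S1)) :
    (l : EReal) ≤ logIntegral (acDensity μ) := by
  have hneg := lintegral_neg_log_acDensity_ne_top hmass hcont
  rw [logIntegral_eq_integral_toReal measurable_acDensity lintegral_acDensity_ne_top hneg,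
    EReal.coe_le_coe_iff]
  obtain ⟨hpos, hint⟩ :=
    ae_pos_and_integrable_log measurable_acDensity lintegral_acDensity_ne_top hneg
  have hlim : Tendsto (fun n => ∫ t, Real.log (clip n (acDensity μ t).toReal) ∂dz) atTop
      (𝓝 (∫ t, Real.log (acDensity μ t).toReal ∂dz)) := by
    refine tendsto_integral_of_dominated_convergence _
      (fun n => (integrable_log_clip_acDensity n).aestronglyMeasurable) hint.abs
      (fun n => hpos.mono fun t ht => abs_log_clip_le n ht.1) (hpos.mono fun t ht => ?_)
    refine tendsto_const_nhds.congr' ?_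
    filter_upwards [eventually_clip_eq ht.1] with n hn
    rw [hn]
  have hl : Tendsto (fun n : ℕ => l - 2 * (n + 1 : ℝ)⁻¹) atTop (𝓝 (l - 2 * 0)) := by
    have := tendsto_one_div_add_atTop_nhds_zero_nat (𝕜 := ℝ)
    simp only [one_div] at this
    exact (this.const_mul 2).const_sub l
  simpa using le_of_tendsto_of_tendsto' hl hlim (sub_le_integral_log_clip hmass hcont)

end Szego

/-! ### Generalized Riesz products: tails, partial products and the two bounds -/

theorem integral_sqMeasure (f : C(S1, ℂ)) (g : S1 → ℝ) :
    ∫ t, g t ∂(sqMeasure f : Measure S1) = ∫ t, ‖f t‖ ^ 2 * g t ∂dz := by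
  have hm : Measurable fun t => ENNReal.ofReal (‖f t‖ ^ 2) := by fun_prop
  change ∫ t, g t ∂(dz.withDensity fun t => ENNReal.ofReal (‖f t‖ ^ 2)) = _
  rw [integral_withDensity_eq_integral_toReal_smul hm (by simp)]
  simp

theorem measure_univ_eq_one_of_tendsto {f : ℕ → C(S1, ℂ)} {ν : FiniteMeasure S1}
    (hf : ∀ n, ∫ t, ‖f n t‖ ^ 2 ∂dz = 1) (h : Tendsto (fun n => sqMeasure (f n)) atTop (𝓝 ν)) :
    (ν : Measure S1) Set.univ = 1 := by
  have h1 := FiniteMeasure.tendsto_iff_forall_integral_tendsto.1 h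
    (BoundedContinuousFunction.const S1 1)
  simp only [integral_sqMeasure, BoundedContinuousFunction.const_apply, mul_one, hf] at h1
  have h2 := tendsto_nhds_unique h1 tendsto_const_nhds
  rw [integral_const, smul_eq_mul, mul_one, measureReal_def] at h2
  exact (ENNReal.toReal_eq_one_iff _).1 h2

section

variable {P : ℕ → ℂ[T;T⁻¹]} {μ : FiniteMeasure S1}

theorem IsGeneralizedRieszProduct.measure_univ (hμ : IsGeneralizedRieszProduct P μ) :
    (μ : Measure S1) Set.univ = 1 :=
  measure_univ_eq_one_of_tendsto (fun n => hμ.integral_eq_one (Finset.range n)) hμ.tendsto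

/-- A generalized Riesz product is the product of `n` factors and of a tail of mass one. -/
theorem IsGeneralizedRieszProduct.exists_eq_withDensity (hμ : IsGeneralizedRieszProduct P μ)
    (n : ℕ) : ∃ ν : FiniteMeasure S1, (ν : Measure S1) Set.univ = 1 ∧
      (μ : Measure S1) = (ν : Measure S1).withDensity fun t =>
        ENNReal.ofReal (‖(∏ j ∈ Finset.range n, trigFun (P j)) t‖ ^ 2) := by
  -- The tail comes from the weak-limit hypothesis for the sequence `n, n + 1, …`.
  obtain ⟨ν, hν⟩ := hμ.exists_weak_limit (fun k => n + k) fun a b h => by simpa using h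
  set f := ∏ j ∈ Finset.range n, trigFun (P j) with hf
  have hcont : Continuous fun t => ‖f t‖ ^ 2 := by fun_prop
  have hm : Measurable fun t => ENNReal.ofReal (‖f t‖ ^ 2) := by fun_prop
  refine ⟨ν, measure_univ_eq_one_of_tendsto (fun m => ?_) hν, ?_⟩
  · simpa using hμ.integral_eq_one ((Finset.range m).map (addLeftEmbedding n))
  have hfin : IsFiniteMeasure
      ((ν : Measure S1).withDensity fun t => ENNReal.ofReal (‖f t‖ ^ 2)) :=
    isFiniteMeasure_withDensity_ofReal (hcont.integrable_of_hasCompactSupport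
      (HasCompactSupport.of_compactSpace _)).hasFiniteIntegral
  refine ext_of_forall_integral_eq_of_IsFiniteMeasure fun g => ?_
  rw [integral_withDensity_eq_integral_toReal_smul hm (by simp)]
  simp only [ENNReal.toReal_ofReal (sq_nonneg _), smul_eq_mul]
  have h1 := (FiniteMeasure.tendsto_iff_forall_integral_tendsto.1 hμ.tendsto g).comp
    (tendsto_add_atTop_nat n)
  have h2 := FiniteMeasure.tendsto_iff_forall_integral_tendsto.1 hν
    -- Testing the tail against `|f|² g` gives the same integrals as testing the full products
    -- against `g`, so the two limits agree.
    (BoundedContinuousFunction.mkOfCompact ⟨fun t => ‖f t‖ ^ 2 * g t, by fun_prop⟩)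
  refine tendsto_nhds_unique h1 (h2.congr fun m => ?_)
  simp only [Function.comp_apply, integral_sqMeasure, BoundedContinuousFunction.mkOfCompact_apply,
    ContinuousMap.coe_mk]
  refine integral_congr_ae (.of_forall fun t => ?_)
  simp only
  rw [add_comm m n, Finset.prod_range_add, ← hf, ContinuousMap.mul_apply, norm_mul]
  ring

theorem IsGeneralizedRieszProduct.toAnalytic_ne_zero (hμ : IsGeneralizedRieszProduct P μ) (j : ℕ) :
    toAnalytic (P j) ≠ 0 := by
  intro h
  have := hμ.integral_eq_one {j}
  simp [norm_trigFun, h] at this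

theorem norm_prod_trigFun_sq (s : Finset ℕ) (t : S1) :
    ‖(∏ j ∈ s, trigFun (P j)) t‖ ^ 2 = ∏ j ∈ s, ‖trigFun (P j) t‖ ^ 2 := by
  rw [ContinuousMap.coe_prod, Finset.prod_apply, norm_prod, Finset.prod_pow]

theorem IsGeneralizedRieszProduct.ae_trigFun_ne_zero (hμ : IsGeneralizedRieszProduct P μ) :
    ∀ᵐ t ∂dz, ∀ j, 0 < ‖trigFun (P j) t‖ := by
  refine ae_all_iff.2 fun j => ?_
  filter_upwards [ae_eval_ne_zero (hμ.toAnalytic_ne_zero j)] with t ht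
  rw [norm_trigFun]
  exact norm_pos_iff.2 ht

theorem IsGeneralizedRieszProduct.log_prod_ae_eq (hμ : IsGeneralizedRieszProduct P μ)
    (s : Finset ℕ) : (fun t => Real.log (∏ j ∈ s, ‖trigFun (P j) t‖ ^ 2)) =ᵐ[dz]
      fun t => ∑ j ∈ s, 2 * Real.log ‖(toAnalytic (P j)).eval (AddCircle.toCircle t : ℂ)‖ := by
  filter_upwards [hμ.ae_trigFun_ne_zero] with t ht
  rw [Real.log_prod fun j _ => (pow_pos (ht j) 2).ne']
  simp [norm_trigFun]

theorem IsGeneralizedRieszProduct.integrable_log_prod (hμ : IsGeneralizedRieszProduct P μ)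
    (s : Finset ℕ) : Integrable (fun t => Real.log (∏ j ∈ s, ‖trigFun (P j) t‖ ^ 2)) dz :=
  (integrable_finsetSum s fun _ _ => (integrable_log_norm_eval _).const_mul 2).congr
    (hμ.log_prod_ae_eq s).symm

theorem IsGeneralizedRieszProduct.outerConst_pos (hμ : IsGeneralizedRieszProduct P μ) (j : ℕ) :
    0 < outerConst (P j) := by
  rw [outerConst_eq_mahlerMeasure]
  exact Polynomial.mahlerMeasure_pos_of_ne_zero (hμ.toAnalytic_ne_zero j)

theorem integral_log_norm_eval (p : ℂ[T;T⁻¹]) :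
    ∫ t : S1, Real.log ‖(toAnalytic p).eval (AddCircle.toCircle t : ℂ)‖ ∂dz
      = Real.log (outerConst p) := by
  rw [integral_toCircle fun z => Real.log ‖(toAnalytic p).eval z‖, outerConst_eq_mahlerMeasure,
    ← Polynomial.logMahlerMeasure_eq_log_MahlerMeasure, Polynomial.logMahlerMeasure_def]

theorem IsGeneralizedRieszProduct.integral_log_prod (hμ : IsGeneralizedRieszProduct P μ)
    (s : Finset ℕ) : ∫ t, Real.log (∏ j ∈ s, ‖trigFun (P j) t‖ ^ 2) ∂dz
      = Real.log (∏ j ∈ s, outerConst (P j) ^ 2) := by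
  rw [integral_congr_ae (hμ.log_prod_ae_eq s),
    integral_finsetSum s fun _ _ => (integrable_log_norm_eval _).const_mul 2,
    Real.log_prod fun j _ => (pow_pos (hμ.outerConst_pos j) 2).ne']
  refine Finset.sum_congr rfl fun j _ => ?_
  rw [integral_const_mul, integral_log_norm_eval, Real.log_pow, Nat.cast_two]

theorem IsGeneralizedRieszProduct.ae_prod_pos (hμ : IsGeneralizedRieszProduct P μ)
    (s : Finset ℕ) : ∀ᵐ t ∂dz, 0 < ∏ j ∈ s, ‖trigFun (P j) t‖ ^ 2 :=
  hμ.ae_trigFun_ne_zero.mono fun _ ht => Finset.prod_pos fun j _ => pow_pos (ht j) 2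

theorem IsGeneralizedRieszProduct.outerConst_le_one (hμ : IsGeneralizedRieszProduct P μ) (j : ℕ) :
    outerConst (P j) ≤ 1 := by
  have h := exp_integral_log_le (hμ.ae_prod_pos {j})
    (Continuous.integrable_of_hasCompactSupport (by fun_prop)
      (HasCompactSupport.of_compactSpace _)) (hμ.integrable_log_prod {j})
  rw [hμ.integral_log_prod, Finset.prod_singleton, Real.exp_log (pow_pos (hμ.outerConst_pos j) 2)]
    at h
  simp only [← norm_prod_trigFun_sq] at h
  rw [hμ.integral_eq_one] at h
  exact (sq_le_one_iff₀ (hμ.outerConst_pos j).le).1 h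

/-- Finite products decrease as the index set grows and converge to their infimum, which may be `0`.
-/
theorem multipliable_of_nonneg_of_le_one {ι : Type*} {f : ι → ℝ} (h0 : ∀ i, 0 ≤ f i)
    (h1 : ∀ i, f i ≤ 1) : Multipliable f := by
  refine ⟨⨅ s : Finset ι, ∏ i ∈ s, f i, ?_⟩
  rw [HasProd, SummationFilter.unconditional_filter]
  refine tendsto_atTop_ciInf (fun s t hst => ?_) ⟨0, ?_⟩
  · classical
    rw [← Finset.prod_sdiff hst]
    exact mul_le_of_le_one_left (Finset.prod_nonneg fun i _ => h0 i)
      (Finset.prod_le_one (fun i _ => h0 i) fun i _ => h1 i)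
  · rintro _ ⟨s, rfl⟩
    exact Finset.prod_nonneg fun i _ => h0 i

theorem IsGeneralizedRieszProduct.multipliable (hμ : IsGeneralizedRieszProduct P μ) :
    Multipliable fun k => outerConst (P k) :=
  multipliable_of_nonneg_of_le_one (fun k => (hμ.outerConst_pos k).le) hμ.outerConst_le_one

theorem IsGeneralizedRieszProduct.logIntegral_prod (hμ : IsGeneralizedRieszProduct P μ) (n : ℕ) :
    logIntegral (fun t => ENNReal.ofReal (∏ j ∈ Finset.range n, ‖trigFun (P j) t‖ ^ 2))
      = ENNReal.log (ENNReal.ofReal (∏ j ∈ Finset.range n, outerConst (P j) ^ 2)) := by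
  rw [logIntegral_eq_integral ((hμ.ae_prod_pos _).mono fun t ht => ⟨ht, rfl⟩)
    (hμ.integrable_log_prod _), hμ.integral_log_prod,
    ENNReal.log_ofReal_of_pos (Finset.prod_pos fun j _ => pow_pos (hμ.outerConst_pos j) 2)]

theorem IsGeneralizedRieszProduct.tendsto_log_prod (hμ : IsGeneralizedRieszProduct P μ) :
    Tendsto (fun n => ENNReal.log (ENNReal.ofReal (∏ j ∈ Finset.range n, outerConst (P j) ^ 2)))
      atTop (𝓝 (ENNReal.log (ENNReal.ofReal (∏' k, outerConst (P k) ^ 2)))) :=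
  (ENNReal.continuous_log.tendsto _).comp (ENNReal.tendsto_ofReal
    (hμ.multipliable.hasProd.pow 2).multipliable.hasProd.tendsto_prod_nat)

theorem IsGeneralizedRieszProduct.logIntegral_acDensity_le (hμ : IsGeneralizedRieszProduct P μ)
    (n : ℕ) : logIntegral (acDensity μ)
      ≤ ENNReal.log (ENNReal.ofReal (∏ j ∈ Finset.range n, outerConst (P j) ^ 2)) := by
  obtain ⟨ν, hν, hμν⟩ := hμ.exists_eq_withDensity n
  rw [ENNReal.log_ofReal_of_pos (Finset.prod_pos fun j _ => pow_pos (hμ.outerConst_pos j) 2),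
    ← hμ.integral_log_prod]
  refine logIntegral_mul_le measurable_acDensity lintegral_acDensity_ne_top
    (measurable_acDensity (μ := ν)) (hν ▸ lintegral_acDensity_le) (hμ.ae_prod_pos _)
    (hμ.integrable_log_prod _) ?_
  have := Measure.rnDeriv_withDensity_left (μ := (ν : Measure S1)) (ν := dz)
    (f := fun t => ENNReal.ofReal (‖(∏ j ∈ Finset.range n, trigFun (P j)) t‖ ^ 2))
    (by fun_prop) (by simp)
  rw [← hμν] at this
  filter_upwards [this] with t ht
  rw [← norm_prod_trigFun_sq]
  exact ht

theorem IsGeneralizedRieszProduct.tprod_le_prod (hμ : IsGeneralizedRieszProduct P μ) (n : ℕ) :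
    ∏' k, outerConst (P k) ^ 2 ≤ ∏ j ∈ Finset.range n, outerConst (P j) ^ 2 := by
  refine Antitone.le_of_tendsto (antitone_nat_of_succ_le fun m => ?_)
    (hμ.multipliable.hasProd.pow 2).multipliable.hasProd.tendsto_prod_nat n
  rw [Finset.prod_range_succ]
  exact mul_le_of_le_one_right (Finset.prod_nonneg fun j _ => sq_nonneg _)
    (pow_le_one₀ (hμ.outerConst_pos m).le (hμ.outerConst_le_one m))

/-- For each `n`, Jensen's inequality bounds `∫ |P_1 ⋯ P_n|² g dz` from below by a quantity that is
at least the left side. Continuity of `g` lets the bound pass to the weak limit. -/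
theorem IsGeneralizedRieszProduct.exp_add_integral_log_le (hμ : IsGeneralizedRieszProduct P μ)
    (hβ : 0 < ∏' k, outerConst (P k) ^ 2) (g : C(S1, ℝ)) (hg : ∀ t, 0 < g t) :
    Real.exp (Real.log (∏' k, outerConst (P k) ^ 2) + ∫ t, Real.log (g t) ∂dz)
      ≤ ∫ t, g t ∂(μ : Measure S1) := by
  have hlim := FiniteMeasure.tendsto_iff_forall_integral_tendsto.1 hμ.tendsto
    (BoundedContinuousFunction.mkOfCompact g)
  refine ge_of_tendsto' hlim fun n => ?_
  simp only [integral_sqMeasure, BoundedContinuousFunction.mkOfCompact_apply, norm_prod_trigFun_sq]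
  have hlg : Integrable (fun t => Real.log (g t)) dz :=
    (g.continuous.log fun t => (hg t).ne').integrable_of_hasCompactSupport
      (HasCompactSupport.of_compactSpace _)
  have hF := hμ.integrable_log_prod (Finset.range n)
  have hlog : (fun t => Real.log ((∏ j ∈ Finset.range n, ‖trigFun (P j) t‖ ^ 2) * g t)) =ᵐ[dz]
      fun t => Real.log (∏ j ∈ Finset.range n, ‖trigFun (P j) t‖ ^ 2) + Real.log (g t) :=
    (hμ.ae_prod_pos _).mono fun t ht => Real.log_mul ht.ne' (hg t).ne'
  refine le_trans ?_ (exp_integral_log_le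
    ((hμ.ae_prod_pos (Finset.range n)).mono fun t ht => mul_pos ht (hg t))
    (Continuous.integrable_of_hasCompactSupport (by fun_prop)
      (HasCompactSupport.of_compactSpace _)) ((hF.add hlg).congr hlog.symm))
  rw [integral_congr_ae hlog, integral_add hF hlg, hμ.integral_log_prod, Real.exp_le_exp]
  gcongr
  exact hμ.tprod_le_prod n

theorem IsGeneralizedRieszProduct.logIntegral_acDensity (hμ : IsGeneralizedRieszProduct P μ) :
    logIntegral (acDensity μ) = ENNReal.log (ENNReal.ofReal (∏' k, outerConst (P k) ^ 2)) := by
  refine le_antisymm (ge_of_tendsto' hμ.tendsto_log_prod hμ.logIntegral_acDensity_le) ?_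
  rcases le_or_gt (∏' k, outerConst (P k) ^ 2) 0 with h | h
  · rw [ENNReal.ofReal_of_nonpos h, ENNReal.log_zero]
    exact bot_le
  · rw [ENNReal.log_ofReal_of_pos h]
    exact le_logIntegral_acDensity hμ.measure_univ.le (hμ.exp_add_integral_log_le h)

theorem IsGeneralizedRieszProduct.logIntegrable_iff (hμ : IsGeneralizedRieszProduct P μ) :
    LogIntegrable (acDensity μ) ↔ 0 < ∏' k, outerConst (P k) := by
  rw [RieszProduct.logIntegrable_iff measurable_acDensity lintegral_acDensity_ne_top,
    hμ.logIntegral_acDensity, Ne, ENNReal.log_eq_bot_iff, ENNReal.ofReal_eq_zero, not_le,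
    (hμ.multipliable.hasProd.pow 2).tprod_eq]
  have h0 : 0 ≤ ∏' k, outerConst (P k) :=
    ge_of_tendsto' hμ.multipliable.hasProd.tendsto_prod_nat
      fun n => Finset.prod_nonneg fun j _ => (hμ.outerConst_pos j).le
  exact ⟨fun h => h0.lt_of_ne' fun h' => by simp [h'] at h, fun h => pow_pos h 2⟩

end

/-! ### Outer polynomials -/

theorem toAnalytic_eq_trunc {p : ℂ[T;T⁻¹]} (hneg : ∀ n < 0, p.coeff n = 0) (h0 : p.coeff 0 ≠ 0) :
    toAnalytic p = LaurentPolynomial.trunc p := by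
  have hmin : p.coeff.support.min = ((0 : ℤ) : WithTop ℤ) := by
    refine le_antisymm (Finset.min_le (Finsupp.mem_support_iff.2 h0)) (Finset.le_min fun n hn => ?_)
    rw [WithTop.coe_le_coe]
    by_contra h
    exact Finsupp.mem_support_iff.1 hn (hneg n (not_le.1 h))
  rw [toAnalytic, hmin]
  simp

/-- Without roots in the open disc each `max 1 |a|` is `|a|`, and the Mahler measure becomes Vieta's
product for the constant term. -/
theorem outerConst_eq_norm_coeff_zero {p : ℂ[T;T⁻¹]} (hneg : ∀ n < 0, p.coeff n = 0)
    (hroot : ∀ a : ℂ, ‖a‖ < 1 → (LaurentPolynomial.trunc p).eval a ≠ 0) :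
    outerConst p = ‖p.coeff 0‖ := by
  have hc : (LaurentPolynomial.trunc p).coeff 0 = p.coeff 0 := coeff_trunc p 0
  have h0 : p.coeff 0 ≠ 0 := by
    have := hroot 0 (by simp)
    rwa [← Polynomial.coeff_zero_eq_eval_zero, hc] at this
  have hnorm (s : Multiset ℂ) : ‖s.prod‖ = (s.map norm).prod := map_multiset_prod normHom s
  set q := LaurentPolynomial.trunc p with hq
  rw [outerConst_eq_mahlerMeasure, toAnalytic_eq_trunc hneg h0, ← hq, ← hc,
    Polynomial.mahlerMeasure_eq_leadingCoeff_mul_prod_roots,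
    (IsAlgClosed.splits q).coeff_zero_eq_leadingCoeff_mul_prod_roots]
  simp only [norm_mul, norm_pow, norm_neg, norm_one, one_pow, one_mul, hnorm]
  congr 2
  refine Multiset.map_congr rfl fun a ha => max_eq_right ?_
  by_contra h
  exact hroot a (not_le.1 h) (Polynomial.isRoot_of_mem_roots ha)

theorem fourierCoeff_fourier (m n : ℤ) :
    fourierCoeff (fourier m : S1 → ℂ) n = if m = n then 1 else 0 := by
  have h := orthonormal_iff_ite.1 (orthonormal_fourier (T := 2 * Real.pi)) n m
  rw [ContinuousMap.inner_toLp] at h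
  simp only [eq_comm (a := m), ← h, fourierCoeff, fourier_neg, smul_eq_mul, mul_comm]

theorem fourierCoeff_trigFun (p : ℂ[T;T⁻¹]) (n : ℤ) :
    fourierCoeff (trigFun p : S1 → ℂ) n = p.coeff n := by
  have hint (f : C(S1, ℂ)) : Integrable f dz :=
    f.continuous.integrable_of_hasCompactSupport (HasCompactSupport.of_compactSpace _)
  induction p using LaurentPolynomial.induction_on' with
  | add p q hp hq =>
    rw [trigFun_add, ContinuousMap.coe_add, fourierCoeff.add (hint _) (hint _), Pi.add_apply, hp, hq]
    simp
  | C_mul_T m a =>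
    rw [trigFun_C_mul_T, ContinuousMap.coe_smul, fourierCoeff.const_smul, fourierCoeff_fourier,
      coeff_mul_T, LaurentPolynomial.C_apply]
    simp [sub_eq_zero, eq_comm]

theorem toLp_mem_hardyH2 {f : C(S1, ℂ)} :
    ContinuousMap.toLp (E := ℂ) 2 dz ℂ f ∈ hardyH2 ↔ ∀ n < 0, fourierCoeff (f : S1 → ℂ) n = 0 := by
  rw [hardyH2, Set.mem_ofPred_eq, fourierCoeff_congr_ae (ContinuousMap.coeFn_toLp dz f)]

theorem IsOuter.coeff_eq_zero {p : ℂ[T;T⁻¹]} (hp : IsOuter p) {n : ℤ} (hn : n < 0) :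
    p.coeff n = 0 := by
  have hmem : ContinuousMap.toLp (E := ℂ) 2 dz ℂ (trigFun p) ∈ hardyH2 := by
    rw [← hp]
    refine Submodule.le_topologicalClosure _ (Submodule.subset_span ⟨0, ?_⟩)
    refine congrArg (ContinuousMap.toLp (E := ℂ) 2 dz ℂ) (ContinuousMap.ext fun t => ?_)
    simp
  rw [← fourierCoeff_trigFun]
  exact toLp_mem_hardyH2.1 hmem n hn

/-- The Szegő kernel `1 / (1 - ā z)` on the circle. -/
def szegoKernel (a : ℂ) (ha : ‖a‖ < 1) : C(S1, ℂ) where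
  toFun t := (1 - conj a * (AddCircle.toCircle t : ℂ))⁻¹
  continuous_toFun := by
    refine Continuous.inv₀ (continuous_const.sub (continuous_const.mul
      (continuous_subtype_val.comp AddCircle.continuous_toCircle))) fun t h => ?_
    have h1 := congrArg norm (sub_eq_zero.1 h)
    rw [norm_one, norm_mul, Circle.norm_coe, mul_one, RCLike.norm_conj] at h1
    exact ha.ne h1.symm

theorem integral_szegoKernel {a : ℂ} (ha : ‖a‖ < 1) : ∫ t, szegoKernel a ha t ∂dz = 1 := by
  have h : DifferentiableOn ℂ (fun z : ℂ => (1 - conj a * z)⁻¹)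
      (closure (Metric.ball (0 : ℂ) |1|)) := by
    intro z hz
    rw [abs_one, closure_ball _ one_ne_zero, mem_closedBall_zero_iff] at hz
    refine (DifferentiableAt.inv (by fun_prop) fun h => ?_).differentiableWithinAt
    have h1 := congrArg norm (sub_eq_zero.1 h)
    rw [norm_one, norm_mul, RCLike.norm_conj] at h1
    have := mul_le_mul_of_nonneg_left hz (norm_nonneg a)
    linarith
  exact (integral_toCircle fun z => (1 - conj a * z)⁻¹).trans
    (by simpa using h.diffContOnCl.circleAverage)

/-- This is the reproducing property at a zero `a`. On the circle the conjugate kernel is `z / (z -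
a)`, so the integrand is `z q(z)`, whose mean is its value at `0`. -/
theorem integral_mul_conj_szegoKernel {a : ℂ} (ha : ‖a‖ < 1) (q : ℂ[X]) :
    ∫ t, ((Polynomial.X - Polynomial.C a) * q).eval (AddCircle.toCircle t : ℂ)
      * conj (szegoKernel a ha t) ∂dz = 0 := by
  have h : ∀ t : S1, ((Polynomial.X - Polynomial.C a) * q).eval (AddCircle.toCircle t : ℂ)
      * conj (szegoKernel a ha t) = (Polynomial.X * q).eval (AddCircle.toCircle t : ℂ) := by
    intro t
    have hz : (AddCircle.toCircle t : ℂ) ≠ 0 := Circle.coe_ne_zero _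
    have hne : (AddCircle.toCircle t : ℂ) - a ≠ 0 := fun h0 => by
      rw [← sub_eq_zero.1 h0, Circle.norm_coe] at ha
      exact ha.ne rfl
    simp only [szegoKernel, ContinuousMap.coe_mk, map_inv₀, map_sub, map_one, map_mul,
      Complex.conj_conj, ← Circle.coe_inv_eq_conj, Circle.coe_inv, Polynomial.eval_mul,
      Polynomial.eval_sub, Polynomial.eval_X, Polynomial.eval_C]
    have : 1 - a * (AddCircle.toCircle t : ℂ)⁻¹
        = ((AddCircle.toCircle t : ℂ) - a) / (AddCircle.toCircle t : ℂ) := by field_simp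
    rw [this]
    field_simp
  simp only [h]
  refine (integral_toCircle fun z => (Polynomial.X * q).eval z).trans ?_
  have hd : Differentiable ℂ fun z => (Polynomial.X * q).eval z := Polynomial.differentiable _
  rw [hd.diffContOnCl.circleAverage]
  simp

/-- A zero `a` would make every `zⁿ p` orthogonal to the Szegő kernel at `a`, hence also the whole
closed span `H²`. But `1 ∈ H²` has inner product `1` with the kernel. -/
theorem IsOuter.eval_trunc_ne_zero {p : ℂ[T;T⁻¹]} (hp : IsOuter p) {a : ℂ} (ha : ‖a‖ < 1) :
    (LaurentPolynomial.trunc p).eval a ≠ 0 := by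
  intro h0
  obtain ⟨q, hq⟩ := Polynomial.dvd_iff_isRoot.2 h0
  have hpq : p = Polynomial.toLaurent ((Polynomial.X - Polynomial.C a) * q) := by
    rw [← hq, toLaurent_trunc fun n hn => hp.coeff_eq_zero hn]
  have hone : ContinuousMap.toLp (E := ℂ) 2 dz ℂ (fourier 0) ∈ hardyH2 := by
    refine toLp_mem_hardyH2.2 fun n hn => ?_
    rw [fourierCoeff_fourier, if_neg hn.ne']
  rw [← hp] at hone
  let φ := innerSL ℂ (ContinuousMap.toLp (E := ℂ) 2 dz ℂ (szegoKernel a ha))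
  have hle : (Submodule.span ℂ (Set.range fun n : ℕ => ContinuousMap.toLp (E := ℂ) 2 dz ℂ
      (fourier (n : ℤ) * trigFun p))).topologicalClosure ≤ φ.ker := by
    refine Submodule.topologicalClosure_minimal _ (Submodule.span_le.2 ?_) φ.isClosed_ker
    rintro _ ⟨n, rfl⟩
    change inner ℂ (ContinuousMap.toLp (E := ℂ) 2 dz ℂ (szegoKernel a ha))
      (ContinuousMap.toLp (E := ℂ) 2 dz ℂ (fourier (n : ℤ) * trigFun p)) = (0 : ℂ)
    rw [ContinuousMap.inner_toLp, ← integral_mul_conj_szegoKernel ha (Polynomial.X ^ n * q)]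
    refine integral_congr_ae (.of_forall fun t => ?_)
    simp only [ContinuousMap.mul_apply]
    have hf : (fourier (n : ℤ) t : ℂ) = (AddCircle.toCircle t : ℂ) ^ n := by
      simp [AddCircle.toCircle_nsmul]
    rw [hpq, trigFun_toLaurent, hf]
    simp only [Polynomial.eval_mul, Polynomial.eval_pow, Polynomial.eval_X]
    ring
  have h1 : inner ℂ (ContinuousMap.toLp (E := ℂ) 2 dz ℂ (szegoKernel a ha))
      (ContinuousMap.toLp (E := ℂ) 2 dz ℂ (fourier 0)) = (0 : ℂ) := hle hone
  rw [ContinuousMap.inner_toLp] at h1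
  simp only [fourier_zero, one_mul] at h1
  rw [integral_conj, integral_szegoKernel ha] at h1
  simp at h1

theorem IsOuter.outerConst_eq {p : ℂ[T;T⁻¹]} (hp : IsOuter p) : outerConst p = ‖p.coeff 0‖ :=
  outerConst_eq_norm_coeff_zero (fun _ hn => hp.coeff_eq_zero hn) fun _ ha => hp.eval_trunc_ne_zero ha

end RieszProduct

end

theorem mainTheorem3 (P : ℕ → LaurentPolynomial ℂ) (μ : MeasureTheory.FiniteMeasure S1)
    (hμ : IsGeneralizedRieszProduct P μ) :
    -- `∫ log (dμ_a/dz) dz = lim_n ∫ log ∏_{j ≤ n} |P_j|² dz`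
    Tendsto (fun n => logIntegral fun t =>
        ENNReal.ofReal (∏ j ∈ Finset.range n, ‖trigFun (P j) t‖ ^ 2))
      atTop (𝓝 (logIntegral (acDensity μ))) ∧
    -- both sides equal `log ∏_k |α₀⁽ᵏ⁾|²`, where the infinite product converges
    Multipliable (fun k => outerConst (P k)) ∧
    logIntegral (acDensity μ) =
      ENNReal.log (ENNReal.ofReal (∏' k, outerConst (P k) ^ 2)) ∧
    -- for outer polynomials, `α₀⁽ᵏ⁾` is the modulus of the constant term of `P_k`, and
    -- `log (dμ/dz)` is integrable if and only if `β = ∏_k α₀⁽ᵏ⁾ > 0`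
    ((∀ k, IsOuter (P k)) →
      (∀ k, outerConst (P k) = ‖(P k).coeff 0‖) ∧
      (LogIntegrable (acDensity μ) ↔ 0 < ∏' k, outerConst (P k))) := by
  refine ⟨?_, hμ.multipliable, hμ.logIntegral_acDensity, fun hP =>
    ⟨fun k => (hP k).outerConst_eq, hμ.logIntegrable_iff⟩⟩
  simp only [hμ.logIntegral_prod, hμ.logIntegral_acDensity]
  exact hμ.tendsto_log_prod
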